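/- Let $p:[0,1]\to\mathbb R$ be a density, i.e. a piecewise continuous function (finitely many discontinuities, finite one-sided limits) that is positive and bounded away from $0$. Let $\alpha\in(0,\pi]$ and $\beta\in[0,\pi)$, and consider the boundary value problem $$-u''=\lambda p(x)u,\quad x\in(0,1),\quad \lambda\in\mathbb C,\qquad u(0)\cos\alpha+u'(0)\sin\alpha=0,\qquad u(1)\cos\beta+u'(1)\sin\beta=0,$$ where a solution is a function $u\in C^1[0,1]$ satisfying the equation at every point of $(0,1)$ at which $p$ is continuous, and $\lambda$ is an eigenvalue if there is a solution $u\not\equiv0$ of the problem. Then all eigenvalues are real, there is a smallest one, $\lambda_0=\lambda_0(p,\alpha,\beta)$, and its sign depends only on $\alpha$ and $\beta$, as follows: 1. $\lambda_0=0$ if and only if $(\alpha,\beta)\in[\pi/4,\pi]\times[0,3\pi/4]$ and $\cos\alpha\cos\beta-\sin(\alpha-\beta)=0$; 2. $\lambda_0>0$ if and only if $(\alpha,\beta)\in(\pi/4,\pi]\times[0,3\pi/4)$ and $\cos\alpha\cos\beta-\sin(\alpha-\beta)<0$; 3. $\lambda_0<0$ if and only if $(\alpha,\beta)$ satisfies neither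 the condition in 1 nor the one in 2. -/

import Mathlib

open Set Filter Topology

namespace VibratingString

/-- `p` is piecewise continuous on `[0, 1]`: it has only finitely many discontinuities, and
finite one-sided limits everywhere (so, in particular, it is bounded). -/
def PiecewiseContinuous (p : ℝ → ℝ) : Prop :=
  {x ∈ Ioo (0 : ℝ) 1 | ¬ ContinuousAt p x}.Finite ∧
  (∀ x ∈ Ico (0 : ℝ) 1, ∃ l : ℝ, Tendsto p (𝓝[>] x) (𝓝 l)) ∧
  (∀ x ∈ Ioc (0 : ℝ) 1, ∃ l : ℝ, Tendsto p (𝓝[<] x) (𝓝 l))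

/-- Density functions on `[0, 1]`: real-valued, piecewise continuous, positive and bounded away
from `0`. Values of `p` outside `[0, 1]` play no role. -/
structure IsDensity (p : ℝ → ℝ) : Prop where
  piecewiseContinuous : PiecewiseContinuous p
  bounded_away : ∃ m : ℝ, 0 < m ∧ ∀ x ∈ Icc (0 : ℝ) 1, m ≤ p x

/-- `u`, with derivative `u'`, is a solution of `-u'' = lam * p * u` on `(0, 1)`: `u` is
continuously differentiable on `[0, 1]` (one-sidedly at the end points), and the equation holds at
each point of `(0, 1)` at which `p` is continuous. -/
structure IsSolution (p : ℝ → ℝ) (lam : ℂ) (u u' : ℝ → ℂ) : Prop where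
  hasDeriv : ∀ x ∈ Icc (0 : ℝ) 1, HasDerivWithinAt u (u' x) (Icc 0 1) x
  continuousOn_deriv : ContinuousOn u' (Icc 0 1)
  equation : ∀ x ∈ Ioo (0 : ℝ) 1, ContinuousAt p x →
    HasDerivAt u' (-(lam * (p x : ℂ) * u x)) x

/-- `lam` is an eigenvalue of `S(p, α, β)`: the equation `-u'' = lam * p * u` has a nontrivial
solution with `u(0) cos α + u'(0) sin α = 0` and `u(1) cos β + u'(1) sin β = 0`. -/
def IsEigenvalue (p : ℝ → ℝ) (α β : ℝ) (lam : ℂ) : Prop :=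
  ∃ u u' : ℝ → ℂ, IsSolution p lam u u' ∧
    u 0 * (Real.cos α : ℂ) + u' 0 * (Real.sin α : ℂ) = 0 ∧
    u 1 * (Real.cos β : ℂ) + u' 1 * (Real.sin β : ℂ) = 0 ∧
    ∃ x ∈ Icc (0 : ℝ) 1, u x ≠ 0

/-- The lowest eigenvalue `λ₀(p, α, β)`, as the infimum of the real eigenvalues. (That it is itself
an eigenvalue, and that all eigenvalues are real, is not built in here.) -/
noncomputable def lowestEigenvalue (p : ℝ → ℝ) (α β : ℝ) : ℝ :=
  sInf {lam : ℝ | IsEigenvalue p α β (lam : ℂ)}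

/-- The boundary parameters lie on the curve `cos α cos β - sin (α - β) = 0` in
`[π/4, π] × [0, 3π/4]`. -/
def OnCurve (α β : ℝ) : Prop :=
  α ∈ Icc (Real.pi / 4) Real.pi ∧ β ∈ Icc 0 (3 * Real.pi / 4) ∧
    Real.cos α * Real.cos β - Real.sin (α - β) = 0

/-- The boundary parameters lie in the part of `(π/4, π] × [0, 3π/4)` on which
`cos α cos β - sin (α - β) < 0`. -/
def InPositiveRegion (α β : ℝ) : Prop :=
  α ∈ Ioc (Real.pi / 4) Real.pi ∧ β ∈ Ico 0 (3 * Real.pi / 4) ∧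
    Real.cos α * Real.cos β - Real.sin (α - β) < 0

end VibratingString

/-! Every eigenvalue is real because `Im (conj u * u')` is monotone and vanishes at both ends. The
solution `y` for a real parameter `l` that satisfies the boundary condition at `0` depends
continuously on `l`; it is positive on `(0, 1]` for very negative `l` (Riccati comparison) but not
for large `l` (comparison with `sin (π x)`). At the first parameter at which it acquires a zero,
that zero is at `1` and the boundary form at `1` is nonpositive, so the smallest eigenvalue `λ₀`
exists and has an eigenfunction `y` that is positive on `(0, 1)`.

Let `v x = sin α - x cos α`, the solution for `l = 0`. The Wronskian `y' v - y v'` vanishes at `0`,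
equals a positive multiple of `cos α cos β - sin (α - β)` at `1`, and has derivative `-λ₀ p y v`.
If `cos α ≤ sin α`, then `v > 0` on `(0, 1)` and this determines the sign of `λ₀`. If
`sin α < cos α`, then `λ₀ ≥ 0` would make `y` concave and place it below the line `v`, which is
negative at `1`. -/

namespace VibratingString

section OffCountable

variable {f f' : ℝ → ℝ} {a b : ℝ} {P : ℝ → Prop}

theorem le_of_hasDerivAt_pos_off_countable (hP : {x ∈ Ioo a b | ¬ P x}.Countable)
    (hab : a ≤ b) (hf : ContinuousOn f (Icc a b))
    (hd : ∀ x ∈ Ioo a b, P x → HasDerivAt f (f' x) x) (hpos : ∀ x ∈ Ioo a b, P x → 0 < f' x) :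
    f a ≤ f b := by
  by_contra! hlt
  -- Zygmund: at the last point where `f` attains a level `c` avoiding the countable exceptional
  -- image, the derivative exists and is at most zero.
  obtain ⟨c, hc, hbc, hca⟩ := ((hP.image f).dense_compl ℝ).exists_between hlt
  obtain ⟨t, ht, htc⟩ := intermediate_value_Icc' hab hf ⟨hbc.le, hca.le⟩
  have hcompact : IsCompact (Icc a b ∩ f ⁻¹' {c}) := isCompact_Icc.of_isClosed_subset
    (hf.preimage_isClosed_of_isClosed isClosed_Icc isClosed_singleton) inter_subset_left
  obtain ⟨x, ⟨hx, hxc⟩, hlast⟩ := hcompact.exists_isGreatest ⟨t, ht, htc⟩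
  rw [mem_preimage, mem_singleton_iff] at hxc
  have hxI : x ∈ Ioo a b := by
    refine ⟨hx.1.lt_of_ne ?_, hx.2.lt_of_ne ?_⟩
    · rintro rfl
      exact hca.ne' hxc
    · rintro rfl
      exact hbc.ne hxc
  have hPx : P x := by
    by_contra hPx
    exact hc ⟨x, ⟨hxI, hPx⟩, hxc⟩
  have hright : ∀ z ∈ Ioc x b, f z ≤ c := by
    intro z hz
    by_contra! hcz
    obtain ⟨w, hw, hwc⟩ := intermediate_value_Icc' hz.2
      (hf.mono (Icc_subset_Icc_left (hx.1.trans hz.1.le))) ⟨hbc.le, hcz.le⟩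
    exact (hz.1.trans_le hw.1).not_ge
      (hlast ⟨⟨hx.1.trans (hz.1.le.trans hw.1), hw.2⟩, hwc⟩)
  have hslope := (hasDerivWithinAt_iff_tendsto_slope' (self_notMem_Ioi)).1
    (hd x hxI hPx).hasDerivWithinAt
  refine (hpos x hxI hPx).not_ge (le_of_tendsto hslope ?_)
  filter_upwards [Ioc_mem_nhdsGT hxI.2] with z hz
  rw [slope_def_field, hxc]
  exact div_nonpos_of_nonpos_of_nonneg (sub_nonpos.2 (hright z hz)) (sub_nonneg.2 hz.1.le)

theorem monotoneOn_of_hasDerivAt_nonneg_off_countable (hP : {x ∈ Ioo a b | ¬ P x}.Countable)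
    (hf : ContinuousOn f (Icc a b)) (hd : ∀ x ∈ Ioo a b, P x → HasDerivAt f (f' x) x)
    (hnonneg : ∀ x ∈ Ioo a b, P x → 0 ≤ f' x) : MonotoneOn f (Icc a b) := by
  intro x hx y hy hxy
  have hsub : Ioo x y ⊆ Ioo a b := Ioo_subset_Ioo hx.1 hy.2
  have hP' : {t ∈ Ioo x y | ¬ P t}.Countable := hP.mono (inter_subset_inter_left _ hsub)
  have hperturb : ∀ ε > 0, f x + ε * x ≤ f y + ε * y := fun ε hε =>
    le_of_hasDerivAt_pos_off_countable (f := fun t => f t + ε * t) (f' := fun t => f' t + ε) hP' hxy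
      ((hf.mono (Icc_subset_Icc hx.1 hy.2)).add (by fun_prop))
      (fun t ht hPt => (hd t (hsub ht) hPt).add (hasDerivAt_const_mul ε))
      (fun t ht hPt => add_pos_of_nonneg_of_pos (hnonneg t (hsub ht) hPt) hε)
  have hlim : ∀ z, Tendsto (fun ε : ℝ => f z + ε * z) (𝓝[>] 0) (𝓝 (f z)) := fun z =>
    tendsto_nhdsWithin_of_tendsto_nhds
      (Continuous.tendsto' (by fun_prop) 0 (f z) (by simp))
  exact le_of_tendsto_of_tendsto (hlim x) (hlim y)
    (eventually_nhdsWithin_of_forall fun ε hε => hperturb ε hε)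

theorem antitoneOn_of_hasDerivAt_nonpos_off_countable (hP : {x ∈ Ioo a b | ¬ P x}.Countable)
    (hf : ContinuousOn f (Icc a b)) (hd : ∀ x ∈ Ioo a b, P x → HasDerivAt f (f' x) x)
    (hnonpos : ∀ x ∈ Ioo a b, P x → f' x ≤ 0) : AntitoneOn f (Icc a b) := by
  have hneg := monotoneOn_of_hasDerivAt_nonneg_off_countable (f := -f) (f' := -f') hP hf.neg
    (fun x hx hPx => (hd x hx hPx).neg) (fun x hx hPx => neg_nonneg.2 (hnonpos x hx hPx))
  exact fun x hx y hy hxy => neg_le_neg_iff.1 (hneg hx hy hxy)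

theorem hasDerivAt_eq_zero_of_monotoneOn_of_le (hf : MonotoneOn f (Icc a b)) (hab : f b ≤ f a)
    {x d : ℝ} (hx : x ∈ Ioo a b) (hd : HasDerivAt f d x) : d = 0 := by
  have hle : a ≤ b := (hx.1.trans hx.2).le
  have hconst : f =ᶠ[𝓝 x] fun _ => f a := by
    filter_upwards [Icc_mem_nhds hx.1 hx.2] with t ht
    exact le_antisymm ((hf ht (right_mem_Icc.2 hle) ht.2).trans hab)
      (hf (left_mem_Icc.2 hle) ht ht.1)
  exact (hd.congr_of_eventuallyEq hconst.symm).unique (hasDerivAt_const x (f a))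

theorem exists_mem_Ioo_of_countable (hP : {x ∈ Ioo a b | ¬ P x}.Countable) (hab : a < b) :
    ∃ x ∈ Ioo a b, P x := by
  obtain ⟨x, hxP, hx⟩ := (hP.dense_compl ℝ).exists_between hab
  exact ⟨x, hx, not_not.1 fun hPx => hxP ⟨hx, hPx⟩⟩

theorem eqOn_Icc_of_eq_off_countable {E : Type*} [TopologicalSpace E] [T2Space E] {u v : ℝ → E}
    (hP : {x ∈ Ioo a b | ¬ P x}.Countable) (hab : a ≠ b) (hu : ContinuousOn u (Icc a b))
    (hv : ContinuousOn v (Icc a b)) (h : ∀ x ∈ Ioo a b, P x → u x = v x) :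
    EqOn u v (Icc a b) := by
  have hdense : Icc a b ⊆ closure (Ioo a b ∩ {x ∈ Ioo a b | ¬ P x}ᶜ) := by
    rw [← closure_Ioo hab]
    exact closure_minimal ((hP.dense_compl ℝ).open_subset_closure_inter isOpen_Ioo) isClosed_closure
  refine EqOn.of_subset_closure (fun x hx => h x hx.1 ?_) hu hv
    (inter_subset_left.trans Ioo_subset_Icc_self) hdense
  by_contra hPx
  exact hx.2 ⟨hx.1, hPx⟩

theorem lt_of_hasDerivAt_pos_off_countable (hP : {x ∈ Ioo a b | ¬ P x}.Countable)
    (hab : a < b) (hf : ContinuousOn f (Icc a b))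
    (hd : ∀ x ∈ Ioo a b, P x → HasDerivAt f (f' x) x) (hpos : ∀ x ∈ Ioo a b, P x → 0 < f' x) :
    f a < f b := by
  by_contra! hle
  obtain ⟨x, hx, hPx⟩ := exists_mem_Ioo_of_countable hP hab
  have hmono := monotoneOn_of_hasDerivAt_nonneg_off_countable hP hf hd
    fun x hx hPx => (hpos x hx hPx).le
  exact (hpos x hx hPx).ne' (hasDerivAt_eq_zero_of_monotoneOn_of_le hmono hle hx (hd x hx hPx))

theorem strictMonoOn_of_hasDerivAt_pos_off_countable (hP : {x ∈ Ioo a b | ¬ P x}.Countable)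
    (hf : ContinuousOn f (Icc a b)) (hd : ∀ x ∈ Ioo a b, P x → HasDerivAt f (f' x) x)
    (hpos : ∀ x ∈ Ioo a b, P x → 0 < f' x) : StrictMonoOn f (Icc a b) := by
  intro x hx y hy hxy
  have hsub : Ioo x y ⊆ Ioo a b := Ioo_subset_Ioo hx.1 hy.2
  have hP' : {t ∈ Ioo x y | ¬ P t}.Countable := hP.mono (inter_subset_inter_left _ hsub)
  exact lt_of_hasDerivAt_pos_off_countable hP' hxy
    (hf.mono (Icc_subset_Icc hx.1 hy.2)) (fun t ht => hd t (hsub ht)) fun t ht => hpos t (hsub ht)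

theorem eq_zero_of_abs_hasDerivAt_le_off_countable (hP : {x ∈ Ioo a b | ¬ P x}.Countable)
    (hf : ContinuousOn f (Icc a b)) (hd : ∀ x ∈ Ioo a b, P x → HasDerivAt f (f' x) x) {C : ℝ}
    (hbound : ∀ x ∈ Ioo a b, P x → |f' x| ≤ C * f x) (hnonneg : ∀ x ∈ Icc a b, 0 ≤ f x) {x₀ : ℝ}
    (hx₀ : x₀ ∈ Icc a b) (h0 : f x₀ = 0) : ∀ x ∈ Icc a b, f x = 0 := by
  have hexp (k x : ℝ) : HasDerivAt (fun x => Real.exp (k * x)) (Real.exp (k * x) * k) x :=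
    (hasDerivAt_const_mul k).exp
  have hmono : MonotoneOn (fun x => f x * Real.exp (C * x)) (Icc a b) := by
    refine monotoneOn_of_hasDerivAt_nonneg_off_countable hP (hf.mul (by fun_prop))
      (fun x hx hPx => (hd x hx hPx).mul (hexp C x)) fun x hx hPx => ?_
    nlinarith [(abs_le.1 (hbound x hx hPx)).1, Real.exp_pos (C * x)]
  have hanti : AntitoneOn (fun x => f x * Real.exp (-C * x)) (Icc a b) := by
    refine antitoneOn_of_hasDerivAt_nonpos_off_countable hP (hf.mul (by fun_prop))
      (fun x hx hPx => (hd x hx hPx).mul (hexp (-C) x)) fun x hx hPx => ?_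
    nlinarith [(abs_le.1 (hbound x hx hPx)).2, Real.exp_pos (-C * x)]
  intro x hx
  refine le_antisymm ?_ (hnonneg x hx)
  rcases le_total x x₀ with hle | hle
  · exact nonpos_of_mul_nonpos_left (by simpa [h0] using hmono hx hx₀ hle) (Real.exp_pos (C * x))
  · exact nonpos_of_mul_nonpos_left (by simpa [h0] using hanti hx₀ hx hle) (Real.exp_pos (-C * x))

end OffCountable

section Coefficients

variable {p : ℝ → ℝ}

/-- A coefficient for which the initial value problem `-y'' = l p y` is well posed: bounded on
`[0, 1]` and with countably many discontinuities. -/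
structure IsCoefficient (p : ℝ → ℝ) : Prop where
  countable_discontinuities : {x ∈ Ioo (0 : ℝ) 1 | ¬ ContinuousAt p x}.Countable
  bounded : ∃ M : ℝ, ∀ x ∈ Icc (0 : ℝ) 1, |p x| ≤ M

/-- A mass density of a string: a coefficient that is positive and bounded away from `0`. Countably
many discontinuities, with or without one-sided limits, are admitted. -/
structure IsWeight (p : ℝ → ℝ) : Prop extends IsCoefficient p where
  bounded_away : ∃ m : ℝ, 0 < m ∧ ∀ x ∈ Icc (0 : ℝ) 1, m ≤ p x

theorem IsWeight.pos (hp : IsWeight p) {x : ℝ} (hx : x ∈ Icc (0 : ℝ) 1) : 0 < p x := by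
  obtain ⟨m, hm, hmp⟩ := hp.bounded_away
  exact hm.trans_le (hmp x hx)

theorem PiecewiseContinuous.isBounded_image (hp : PiecewiseContinuous p) :
    Bornology.IsBounded (p '' Icc 0 1) := by
  have hright : ∀ x ∈ Icc (0 : ℝ) 1, ∃ s ∈ 𝓝[>] x, Bornology.IsBounded (p '' (Icc 0 1 ∩ s)) := by
    intro x hx
    rcases hx.2.lt_or_eq with hx1 | rfl
    · obtain ⟨c, hc⟩ := hp.2.1 x ⟨hx.1, hx1⟩
      obtain ⟨s, hs, hsb⟩ := Metric.exists_isBounded_image_of_tendsto hc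
      exact ⟨s, hs, hsb.subset (image_mono inter_subset_right)⟩
    · have hempty : Icc (0 : ℝ) 1 ∩ Ioi 1 = ∅ := by grind
      exact ⟨Ioi 1, self_mem_nhdsWithin, by simp [hempty]⟩
  have hleft : ∀ x ∈ Icc (0 : ℝ) 1, ∃ s ∈ 𝓝[<] x, Bornology.IsBounded (p '' (Icc 0 1 ∩ s)) := by
    intro x hx
    rcases hx.1.lt_or_eq with hx0 | rfl
    · obtain ⟨c, hc⟩ := hp.2.2 x ⟨hx0, hx.2⟩
      obtain ⟨s, hs, hsb⟩ := Metric.exists_isBounded_image_of_tendsto hc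
      exact ⟨s, hs, hsb.subset (image_mono inter_subset_right)⟩
    · have hempty : Icc (0 : ℝ) 1 ∩ Iio 0 = ∅ := by grind
      exact ⟨Iio 0, self_mem_nhdsWithin, by simp [hempty]⟩
  refine isCompact_Icc.induction_on (p := fun s => Bornology.IsBounded (p '' s)) (by simp)
    (fun s t hst ht => ht.subset (image_mono hst))
    (fun s t hs ht => by simpa only [image_union] using hs.union ht) fun x hx => ?_
  obtain ⟨s, hs, hsb⟩ := hright x hx
  obtain ⟨t, ht, htb⟩ := hleft x hx
  refine ⟨Icc 0 1 ∩ (insert x (t ∪ s)), inter_mem_nhdsWithin _ ?_, ?_⟩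
  · rw [← nhdsNE_sup_pure, ← nhdsLT_sup_nhdsGT]
    have hs' : insert x (t ∪ s) ∈ 𝓝[>] x := mem_of_superset hs (by grind)
    have ht' : insert x (t ∪ s) ∈ 𝓝[<] x := mem_of_superset ht (by grind)
    simp [hs', ht']
  · rw [inter_insert_of_mem hx, inter_union_distrib_left, image_insert_eq, image_union]
    exact (htb.union hsb).insert (p x)

theorem IsDensity.isWeight (hp : IsDensity p) : IsWeight p where
  countable_discontinuities := hp.piecewiseContinuous.1.countable
  bounded := by
    obtain ⟨M, hM⟩ := hp.piecewiseContinuous.isBounded_image.exists_norm_le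
    exact ⟨M, fun x hx => hM _ (mem_image_of_mem p hx)⟩
  bounded_away := hp.bounded_away

end Coefficients

section ComplexSolutions

variable {p : ℝ → ℝ} {α β : ℝ} {lam : ℂ} {u u' v v' : ℝ → ℂ}

namespace IsSolution

theorem continuousOn (h : IsSolution p lam u u') : ContinuousOn u (Icc 0 1) :=
  fun x hx => (h.hasDeriv x hx).continuousWithinAt

theorem hasDerivAt (h : IsSolution p lam u u') {x : ℝ} (hx : x ∈ Ioo (0 : ℝ) 1) :
    HasDerivAt u (u' x) x :=
  (h.hasDeriv x (Ioo_subset_Icc_self hx)).hasDerivAt (Icc_mem_nhds hx.1 hx.2)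

theorem sub_const_mul (hu : IsSolution p lam u u') (hv : IsSolution p lam v v') (k : ℂ) :
    IsSolution p lam (fun x => u x - k * v x) (fun x => u' x - k * v' x) where
  hasDeriv x hx := (hu.hasDeriv x hx).sub ((hv.hasDeriv x hx).const_mul k)
  continuousOn_deriv := hu.continuousOn_deriv.sub (hv.continuousOn_deriv.const_smul k)
  equation x hx hpx :=
    ((hu.equation x hx hpx).sub ((hv.equation x hx hpx).const_mul k)).congr_deriv (by ring)

end IsSolution

theorem abs_two_inner_add_two_inner_le {a b : ℂ} {q M : ℝ} (hq : |q| ≤ M) :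
    |2 * inner ℝ a b + 2 * inner ℝ b (-(lam * (q : ℂ) * a))| ≤
      (1 + ‖lam‖ * M) * (‖a‖ ^ 2 + ‖b‖ ^ 2) := by
  have hab : |inner ℝ a b| ≤ ‖a‖ * ‖b‖ := abs_real_inner_le_norm a b
  have hba : |inner ℝ b (-(lam * (q : ℂ) * a))| ≤ ‖b‖ * (‖lam‖ * M * ‖a‖) := by
    refine (abs_real_inner_le_norm _ _).trans ?_
    rw [norm_neg, norm_mul, norm_mul, Complex.norm_real, Real.norm_eq_abs]
    gcongr
  have hC : 0 ≤ ‖lam‖ * M := mul_nonneg (norm_nonneg _) ((abs_nonneg q).trans hq)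
  calc |2 * inner ℝ a b + 2 * inner ℝ b (-(lam * (q : ℂ) * a))|
      ≤ 2 * |inner ℝ a b| + 2 * |inner ℝ b (-(lam * (q : ℂ) * a))| := by
        simpa only [abs_mul, abs_two] using
          abs_add_le (2 * inner ℝ a b) (2 * inner ℝ b (-(lam * (q : ℂ) * a)))
    _ ≤ 2 * (‖a‖ * ‖b‖) + 2 * (‖b‖ * (‖lam‖ * M * ‖a‖)) := by gcongr
    _ = (1 + ‖lam‖ * M) * (2 * ‖a‖ * ‖b‖) := by ring
    _ ≤ (1 + ‖lam‖ * M) * (‖a‖ ^ 2 + ‖b‖ ^ 2) := by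
        gcongr
        exact two_mul_le_add_sq _ _

theorem IsSolution.eq_zero (hp : IsCoefficient p) (h : IsSolution p lam u u') {x₀ : ℝ}
    (hx₀ : x₀ ∈ Icc (0 : ℝ) 1) (h0 : u x₀ = 0) (h0' : u' x₀ = 0) :
    ∀ x ∈ Icc (0 : ℝ) 1, u x = 0 := by
  obtain ⟨M, hM⟩ := hp.bounded
  have henergy : ∀ x ∈ Icc (0 : ℝ) 1, ‖u x‖ ^ 2 + ‖u' x‖ ^ 2 = 0 :=
    eq_zero_of_abs_hasDerivAt_le_off_countable hp.countable_discontinuities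
      ((h.continuousOn.norm.pow 2).add (h.continuousOn_deriv.norm.pow 2))
      (fun x hx hpx => (h.hasDerivAt hx).norm_sq.add (h.equation x hx hpx).norm_sq)
      (fun x hx _ => abs_two_inner_add_two_inner_le (hM x (Ioo_subset_Icc_self hx)))
      (fun x _ => by positivity) hx₀ (by simp [h0, h0'])
  intro x hx
  have hsq := ((add_eq_zero_iff_of_nonneg (sq_nonneg _) (sq_nonneg _)).1 (henergy x hx)).1
  exact norm_eq_zero.1 (pow_eq_zero_iff two_ne_zero |>.1 hsq)

theorem IsSolution.deriv_eq_zero (h : IsSolution p lam u u') (hu : ∀ x ∈ Icc (0 : ℝ) 1, u x = 0)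
    {x : ℝ} (hx : x ∈ Icc (0 : ℝ) 1) : u' x = 0 :=
  (uniqueDiffOn_Icc zero_lt_one x hx).eq_deriv _ (h.hasDeriv x hx)
    ((hasDerivWithinAt_const x _ 0).congr hu (hu x hx))

theorem exists_eq_mul_of_mul_add_mul_eq_zero {R : Type*} [CommRing R] {a b c s : R}
    (h : a * c + b * s = 0) (hsc : s ^ 2 + c ^ 2 = 1) : ∃ k, a = k * s ∧ b = -(k * c) :=
  ⟨a * s - b * c, by linear_combination c * h - a * hsc, by linear_combination s * h - b * hsc⟩

theorem im_conj_mul_eq_zero_of_boundary {a b : ℂ} {θ : ℝ}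
    (h : a * (Real.cos θ : ℂ) + b * (Real.sin θ : ℂ) = 0) : (star a * b).im = 0 := by
  obtain ⟨k, rfl, rfl⟩ := exists_eq_mul_of_mul_add_mul_eq_zero h
    (by exact_mod_cast Real.sin_sq_add_cos_sq θ)
  simp
  ring

theorem IsSolution.hasDerivAt_im_conj_mul (h : IsSolution p lam u u') {x : ℝ}
    (hx : x ∈ Ioo (0 : ℝ) 1) (hpx : ContinuousAt p x) :
    HasDerivAt (fun t => (star (u t) * u' t).im) (-(lam.im * (p x * ‖u x‖ ^ 2))) x := by
  refine (Complex.imCLM.hasFDerivAt.comp_hasDerivAt x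
    ((h.hasDerivAt hx).star.mul (h.equation x hx hpx))).congr_deriv ?_
  rw [← Complex.normSq_eq_norm_sq, Complex.normSq_apply]
  simp
  ring

theorem IsEigenvalue.im_eq_zero (hp : IsWeight p) (h : IsEigenvalue p α β lam) : lam.im = 0 := by
  obtain ⟨u, u', hu, h0, h1, x₁, hx₁, hne⟩ := h
  by_contra him
  set G : ℝ → ℝ := fun x => -lam.im * (star (u x) * u' x).im with hG
  have hderiv : ∀ x ∈ Ioo (0 : ℝ) 1, ContinuousAt p x →
      HasDerivAt G (lam.im ^ 2 * (p x * ‖u x‖ ^ 2)) x := fun x hx hpx =>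
    ((hu.hasDerivAt_im_conj_mul hx hpx).const_mul (-lam.im)).congr_deriv (by ring)
  have hcont : ContinuousOn G (Icc 0 1) := continuousOn_const.mul
    (Complex.continuous_im.comp_continuousOn (hu.continuousOn.star.mul hu.continuousOn_deriv))
  have hmono : MonotoneOn G (Icc 0 1) :=
    monotoneOn_of_hasDerivAt_nonneg_off_countable hp.countable_discontinuities hcont hderiv
      fun x hx _ => by
        have := hp.pos (Ioo_subset_Icc_self hx)
        positivity
  have hends : G 1 ≤ G 0 := by
    simp only [hG, im_conj_mul_eq_zero_of_boundary h0, im_conj_mul_eq_zero_of_boundary h1, le_refl]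
  refine hne (eqOn_Icc_of_eq_off_countable hp.countable_discontinuities zero_ne_one
    hu.continuousOn continuousOn_const (fun x hx hpx => ?_) hx₁)
  have hzero := hasDerivAt_eq_zero_of_monotoneOn_of_le hmono hends hx (hderiv x hx hpx)
  simpa [him, (hp.pos (Ioo_subset_Icc_self hx)).ne'] using hzero

end ComplexSolutions

section Volterra

open MeasureTheory

variable {p q : ℝ → ℝ} {M : ℝ}

theorem IsCoefficient.integrableOn (hp : IsCoefficient p) : IntegrableOn p (Icc 0 1) := by
  obtain ⟨M, hM⟩ := hp.bounded
  set D := {x ∈ Ioo (0 : ℝ) 1 | ¬ ContinuousAt p x}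
  have hcount : D.Countable := hp.countable_discontinuities
  have hae : (Ioo (0 : ℝ) 1 \ D : Set ℝ) =ᵐ[volume] Icc (0 : ℝ) 1 :=
    (sdiff_null_ae_eq_self (hcount.measure_zero _)).trans Ioo_ae_eq_Icc
  have hmeas : MeasurableSet (Ioo (0 : ℝ) 1 \ D) := measurableSet_Ioo.diff hcount.measurableSet
  have hcont : ContinuousOn p (Ioo 0 1 \ D) := fun x hx =>
    (not_not.1 fun hpx => hx.2 ⟨hx.1, hpx⟩ : ContinuousAt p x).continuousWithinAt
  rw [← integrableOn_congr_set_ae hae]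
  refine IntegrableOn.of_bound ((measure_mono sdiff_subset).trans_lt measure_Ioo_lt_top)
    (hcont.aestronglyMeasurable hmeas) M ?_
  filter_upwards [ae_restrict_mem hmeas] with x hx
  exact hM x (Ioo_subset_Icc_self hx.1)

theorem intervalIntegrable_mul_iccExtend (hq : IntegrableOn q (Icc 0 1)) (f : C(Icc (0 : ℝ) 1, ℝ))
    {x : ℝ} (hx : x ∈ Icc (0 : ℝ) 1) :
    IntervalIntegrable (fun t => q t * IccExtend (zero_le_one' ℝ) f t) volume 0 x := by
  refine IntervalIntegrable.mul_continuousOn ?_ f.continuous.Icc_extend'.continuousOn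
  refine (hq.mono_set ?_).intervalIntegrable
  rw [uIcc_of_le hx.1]
  exact Icc_subset_Icc_right hx.2

theorem continuousOn_integral_mul_iccExtend (hq : IntegrableOn q (Icc 0 1))
    (f : C(Icc (0 : ℝ) 1, ℝ)) :
    ContinuousOn (fun x => ∫ t in (0 : ℝ)..x, q t * IccExtend (zero_le_one' ℝ) f t)
      (Icc 0 1) := by
  simpa only [uIcc_of_le zero_le_one] using intervalIntegral.continuousOn_primitive_interval'
    (intervalIntegrable_mul_iccExtend hq f (right_mem_Icc.2 zero_le_one)) left_mem_uIcc

theorem abs_integral_mul_iccExtend_le (hq : IntegrableOn q (Icc 0 1)) (f : C(Icc (0 : ℝ) 1, ℝ))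
    {x : ℝ} (hx : x ∈ Icc (0 : ℝ) 1) :
    |∫ t in (0 : ℝ)..x, q t * IccExtend (zero_le_one' ℝ) f t| ≤
      (∫ t in (0 : ℝ)..1, |q t|) * ‖f‖ := by
  have hint : IntervalIntegrable (fun t => |q t| * ‖f‖) volume 0 1 :=
    ((uIcc_of_le (zero_le_one' ℝ) ▸ hq).intervalIntegrable.abs).mul_const ‖f‖
  rw [← Real.norm_eq_abs, ← intervalIntegral.integral_mul_const]
  refine (intervalIntegral.norm_integral_le_of_norm_le hx.1 (ae_of_all _ fun t _ => ?_)
    (hint.mono_set ?_)).trans (intervalIntegral.integral_mono_interval le_rfl hx.1 hx.2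
      (ae_of_all _ fun t => by positivity) hint)
  · rw [norm_mul, Real.norm_eq_abs]
    gcongr
    exact f.norm_coe_le_norm _
  · rw [uIcc_of_le hx.1, uIcc_of_le zero_le_one]
    exact Icc_subset_Icc_right hx.2

/-- The Volterra operator `f ↦ ∫₀ˣ q f` on the space of continuous functions on `[0, 1]`. -/
noncomputable def volterraOperator (q : ℝ → ℝ) (hq : IntegrableOn q (Icc 0 1)) :
    C(Icc (0 : ℝ) 1, ℝ) →L[ℝ] C(Icc (0 : ℝ) 1, ℝ) :=
  LinearMap.mkContinuous
    { toFun := fun f => ⟨fun x => ∫ t in (0 : ℝ)..x, q t * IccExtend (zero_le_one' ℝ) f t,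
        (continuousOn_integral_mul_iccExtend hq f).comp_continuous continuous_subtype_val
          fun x => x.2⟩
      map_add' := fun f g => by
        ext x
        simp only [ContinuousMap.coe_mk, ContinuousMap.add_apply]
        rw [← intervalIntegral.integral_add (intervalIntegrable_mul_iccExtend hq f x.2)
          (intervalIntegrable_mul_iccExtend hq g x.2)]
        simp only [IccExtend, Function.comp_apply, ContinuousMap.add_apply, mul_add]
      map_smul' := fun c f => by
        ext x
        simp only [ContinuousMap.coe_mk, ContinuousMap.smul_apply, RingHom.id_apply, smul_eq_mul,
          ← intervalIntegral.integral_const_mul, IccExtend, Function.comp_apply, mul_left_comm] }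
    (∫ t in (0 : ℝ)..1, |q t|) fun f => (ContinuousMap.norm_le _ (mul_nonneg
      (intervalIntegral.integral_nonneg zero_le_one fun _ _ => abs_nonneg _) (norm_nonneg f))).2
        fun x => abs_integral_mul_iccExtend_le hq f x.2

theorem volterraOperator_apply (hq : IntegrableOn q (Icc 0 1)) (f : C(Icc (0 : ℝ) 1, ℝ))
    (x : Icc (0 : ℝ) 1) :
    volterraOperator q hq f x = ∫ t in (0 : ℝ)..x, q t * IccExtend (zero_le_one' ℝ) f t :=
  rfl

theorem abs_volterraOperator_le (hq : IntegrableOn q (Icc 0 1))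
    (hM : ∀ x ∈ Icc (0 : ℝ) 1, |q x| ≤ M) {f : C(Icc (0 : ℝ) 1, ℝ)} {C : ℝ} {n : ℕ}
    (hf : ∀ x, |f x| ≤ C * ((x : ℝ) ^ n / n.factorial)) (x : Icc (0 : ℝ) 1) :
    |volterraOperator q hq f x| ≤ M * C * ((x : ℝ) ^ (n + 1) / (n + 1).factorial) := by
  have hint : IntervalIntegrable (fun t => M * C / n.factorial * t ^ n) volume 0 x :=
    Continuous.intervalIntegrable (by fun_prop) _ _
  have hle : |volterraOperator q hq f x| ≤ ∫ t in (0 : ℝ)..x, M * C / n.factorial * t ^ n := by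
    rw [volterraOperator_apply, ← Real.norm_eq_abs]
    refine intervalIntegral.norm_integral_le_of_norm_le x.2.1 (ae_of_all _ fun t ht => ?_) hint
    have htI : t ∈ Icc (0 : ℝ) 1 := ⟨ht.1.le, ht.2.trans x.2.2⟩
    rw [norm_mul, IccExtend_of_mem _ _ htI, Real.norm_eq_abs, Real.norm_eq_abs]
    calc |q t| * |f ⟨t, htI⟩| ≤ M * (C * (t ^ n / n.factorial)) :=
          mul_le_mul (hM t htI) (hf ⟨t, htI⟩) (abs_nonneg _) ((abs_nonneg _).trans (hM t htI))
      _ = M * C / n.factorial * t ^ n := by ring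
  refine hle.trans_eq ?_
  rw [intervalIntegral.integral_const_mul, integral_pow, Nat.factorial_succ]
  push_cast
  field_simp
  simp

theorem integrableOn_one_Icc : IntegrableOn (1 : ℝ → ℝ) (Icc 0 1) :=
  integrableOn_const (by simp)

theorem norm_volterraOperator_mul_pow_le (hq : IntegrableOn q (Icc 0 1))
    (hM : ∀ x ∈ Icc (0 : ℝ) 1, |q x| ≤ M) (n : ℕ) :
    ‖(volterraOperator 1 integrableOn_one_Icc * volterraOperator q hq) ^ n‖ ≤
      M ^ n / n.factorial := by
  set K := volterraOperator 1 integrableOn_one_Icc * volterraOperator q hq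
  have hM0 : 0 ≤ M := (abs_nonneg _).trans (hM 0 (left_mem_Icc.2 zero_le_one))
  have hiter : ∀ f x, |(K ^ n) f x| ≤
      M ^ n * ‖f‖ * ((x : ℝ) ^ (2 * n) / (2 * n).factorial) := by
    induction n with
    | zero => intro f x; simpa using f.norm_coe_le_norm x
    | succ n ih =>
      intro f x
      rw [pow_succ']
      refine (abs_volterraOperator_le integrableOn_one_Icc (M := 1) (by simp)
        (abs_volterraOperator_le hq hM (ih f)) x).trans_eq ?_
      rw [show 2 * (n + 1) = 2 * n + 1 + 1 by ring]
      ring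
  refine ContinuousLinearMap.opNorm_le_bound _ (by positivity) fun f =>
    (ContinuousMap.norm_le _ (by positivity)).2 fun x => (hiter f x).trans ?_
  have hpow : (x : ℝ) ^ (2 * n) ≤ 1 := pow_le_one₀ x.2.1 x.2.2
  have hfact : (n.factorial : ℝ) ≤ (2 * n).factorial := by
    exact_mod_cast Nat.factorial_le (by lia)
  calc M ^ n * ‖f‖ * ((x : ℝ) ^ (2 * n) / (2 * n).factorial)
      ≤ M ^ n * ‖f‖ * (1 / n.factorial) := by gcongr
    _ = M ^ n / n.factorial * ‖f‖ := by ring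

section NormedRing

variable {R : Type*} [NormedRing R] [CompleteSpace R]

theorem isUnit_one_sub_of_norm_pow_lt_one {a : R} {n : ℕ} (h : ‖a ^ n‖ < 1) : IsUnit (1 - a) := by
  have hunit : IsUnit (1 - a ^ n) := (Units.oneSub (a ^ n) h).isUnit
  have hcomm : Commute (1 - a) (∑ i ∈ Finset.range n, a ^ i) :=
    (Commute.one_left _).sub_left
      (Commute.sum_right _ _ _ fun i _ => (Commute.refl a).pow_right i)
  rw [← mul_neg_geom_sum a n, hcomm.isUnit_mul_iff] at hunit
  exact hunit.1

variable [NormedAlgebra ℝ R] {K : R}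

theorem isUnit_one_add_smul_of_norm_pow_le (hK : ∀ n : ℕ, ‖K ^ n‖ ≤ M ^ n / n.factorial) (l : ℝ) :
    IsUnit (1 + l • K) := by
  obtain ⟨n, hn⟩ := ((FloorSemiring.tendsto_pow_div_factorial_atTop (|l| * M)).eventually_lt_const
    zero_lt_one).exists
  have hpow : ‖((-l) • K) ^ n‖ < 1 := by
    rw [smul_pow, norm_smul, norm_pow, norm_neg, Real.norm_eq_abs]
    calc |l| ^ n * ‖K ^ n‖ ≤ |l| ^ n * (M ^ n / n.factorial) := by
          gcongr
          exact hK n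
      _ = (|l| * M) ^ n / n.factorial := by ring
      _ < 1 := hn
  simpa using isUnit_one_sub_of_norm_pow_lt_one hpow

theorem continuous_inverse_one_add_smul (hK : ∀ l : ℝ, IsUnit (1 + l • K)) :
    Continuous fun l : ℝ => Ring.inverse (1 + l • K) := by
  refine continuous_iff_continuousAt.2 fun l => ?_
  obtain ⟨v, hv⟩ := hK l
  exact ContinuousAt.comp (g := Ring.inverse) (hv ▸ NormedRing.inverse_continuousAt v)
    (by fun_prop : ContinuousAt (fun l : ℝ => 1 + l • K) l)

end NormedRing

end Volterra

section RealSolutions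

open MeasureTheory

variable {p : ℝ → ℝ} {l a b : ℝ} {y y' : ℝ → ℝ}

/-- A real solution of `-y'' = l * p * y` on `[0, 1]`, with derivative `y'`; the real counterpart
of `IsSolution`. -/
structure IsRealSolution (p : ℝ → ℝ) (l : ℝ) (y y' : ℝ → ℝ) : Prop where
  hasDeriv : ∀ x ∈ Icc (0 : ℝ) 1, HasDerivWithinAt y (y' x) (Icc 0 1) x
  continuousOn_deriv : ContinuousOn y' (Icc 0 1)
  equation : ∀ x ∈ Ioo (0 : ℝ) 1, ContinuousAt p x → HasDerivAt y' (-(l * p x * y x)) x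

theorem exists_continuous_volterra_system_solution (hp : IsCoefficient p) (a b : ℝ) :
    ∃ Y Y' : ℝ → C(Icc (0 : ℝ) 1, ℝ), Continuous Y ∧ Continuous Y' ∧ ∀ l,
      Y l = ContinuousMap.const _ a + volterraOperator 1 integrableOn_one_Icc (Y' l) ∧
      Y' l = ContinuousMap.const _ b - l • volterraOperator p hp.integrableOn (Y l) := by
  obtain ⟨M, hM⟩ := hp.bounded
  set J₁ := volterraOperator 1 integrableOn_one_Icc
  set J := volterraOperator p hp.integrableOn
  set A : C(Icc (0 : ℝ) 1, ℝ) := ContinuousMap.const _ a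
  set B : C(Icc (0 : ℝ) 1, ℝ) := ContinuousMap.const _ b
  have hunit : ∀ l : ℝ, IsUnit (1 + l • (J₁ * J)) :=
    isUnit_one_add_smul_of_norm_pow_le (R := C(Icc (0 : ℝ) 1, ℝ) →L[ℝ] C(Icc (0 : ℝ) 1, ℝ))
      (norm_volterraOperator_mul_pow_le hp.integrableOn hM)
  -- Eliminating `Y'` from the system leaves `(1 + l J₁ J) Y = A + J₁ B`.
  let Y : ℝ → C(Icc (0 : ℝ) 1, ℝ) := fun l => Ring.inverse (1 + l • (J₁ * J)) (A + J₁ B)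
  have hY : Continuous Y := (continuous_inverse_one_add_smul
    (R := C(Icc (0 : ℝ) 1, ℝ) →L[ℝ] C(Icc (0 : ℝ) 1, ℝ)) hunit).clm_apply continuous_const
  refine ⟨Y, fun l => B - l • J (Y l), hY, by fun_prop, fun l => ⟨?_, rfl⟩⟩
  have hsolve : Y l + l • J₁ (J (Y l)) = A + J₁ B :=
    congrArg (fun T : C(Icc (0 : ℝ) 1, ℝ) →L[ℝ] C(Icc (0 : ℝ) 1, ℝ) => T (A + J₁ B))
      (Ring.mul_inverse_cancel _ (hunit l))
  rw [map_sub, map_smul, ← add_sub_assoc, ← hsolve, add_sub_cancel_right]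

theorem isRealSolution_iccExtend (hp : IsCoefficient p) {Y Y' : C(Icc (0 : ℝ) 1, ℝ)}
    (hY : Y = ContinuousMap.const _ a + volterraOperator 1 integrableOn_one_Icc Y')
    (hY' : Y' = ContinuousMap.const _ b - l • volterraOperator p hp.integrableOn Y) :
    IsRealSolution p l (IccExtend (zero_le_one' ℝ) Y) (IccExtend (zero_le_one' ℝ) Y') where
  hasDeriv x hx := by
    have hcont : Continuous (IccExtend (zero_le_one' ℝ) Y') := Y'.continuous.Icc_extend'
    have hderiv := (hcont.integral_hasStrictDerivAt 0 x).hasDerivAt.const_add a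
    refine hderiv.hasDerivWithinAt.congr_of_mem (fun t ht => ?_) hx
    rw [IccExtend_of_mem _ _ ht, hY]
    simp [volterraOperator_apply]
  continuousOn_deriv := Y'.continuous.Icc_extend'.continuousOn
  equation x hx hpx := by
    have hcont : Continuous (IccExtend (zero_le_one' ℝ) Y) := Y.continuous.Icc_extend'
    have hmeas : StronglyMeasurableAtFilter (fun t => p t * IccExtend (zero_le_one' ℝ) Y t) (𝓝 x) :=
      AEStronglyMeasurable.stronglyMeasurableAtFilter_of_mem
        (hp.integrableOn.aestronglyMeasurable.mul hcont.aestronglyMeasurable)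
        (Icc_mem_nhds hx.1 hx.2)
    have hderiv := intervalIntegral.integral_hasDerivAt_right
      (intervalIntegrable_mul_iccExtend hp.integrableOn Y (Ioo_subset_Icc_self hx)) hmeas
      (hpx.mul hcont.continuousAt)
    refine (((hderiv.const_mul l).const_sub b).congr_of_eventuallyEq ?_).congr_deriv (by ring)
    filter_upwards [Icc_mem_nhds hx.1 hx.2] with t ht
    rw [IccExtend_of_mem _ _ ht, hY']
    simp [volterraOperator_apply]

theorem exists_continuous_solution_family (hp : IsCoefficient p) (a b : ℝ) :
    ∃ y y' : ℝ → ℝ → ℝ, Continuous ↿y ∧ Continuous ↿y' ∧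
      ∀ l, IsRealSolution p l (y l) (y' l) ∧ y l 0 = a ∧ y' l 0 = b := by
  obtain ⟨Y, Y', hYc, hYc', hsys⟩ := exists_continuous_volterra_system_solution hp a b
  have hjoint : ∀ {Z : ℝ → C(Icc (0 : ℝ) 1, ℝ)}, Continuous Z →
      Continuous ↿fun l => IccExtend (zero_le_one' ℝ) (Z l) := fun hZ =>
    (hZ.comp continuous_fst).eval (continuous_projIcc.comp continuous_snd)
  have h01 : (0 : ℝ) ∈ Icc (0 : ℝ) 1 := left_mem_Icc.2 zero_le_one
  refine ⟨_, _, hjoint hYc, hjoint hYc', fun l =>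
    ⟨isRealSolution_iccExtend hp (hsys l).1 (hsys l).2, ?_, ?_⟩⟩
  · rw [IccExtend_of_mem _ _ h01, (hsys l).1]
    simp [volterraOperator_apply]
  · rw [IccExtend_of_mem _ _ h01, (hsys l).2]
    simp [volterraOperator_apply]

end RealSolutions

section RealSolutionLemmas

variable {p : ℝ → ℝ} {l : ℝ} {y y' : ℝ → ℝ}

namespace IsRealSolution

theorem continuousOn (h : IsRealSolution p l y y') : ContinuousOn y (Icc 0 1) :=
  fun x hx => (h.hasDeriv x hx).continuousWithinAt

theorem hasDerivAt (h : IsRealSolution p l y y') {x : ℝ} (hx : x ∈ Ioo (0 : ℝ) 1) :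
    HasDerivAt y (y' x) x :=
  (h.hasDeriv x (Ioo_subset_Icc_self hx)).hasDerivAt (Icc_mem_nhds hx.1 hx.2)

theorem ofReal (h : IsRealSolution p l y y') :
    IsSolution p (l : ℂ) (fun x => (y x : ℂ)) (fun x => (y' x : ℂ)) where
  hasDeriv x hx := (h.hasDeriv x hx).ofReal_comp
  continuousOn_deriv := Complex.continuous_ofReal.comp_continuousOn h.continuousOn_deriv
  equation x hx hpx := by simpa using (h.equation x hx hpx).ofReal_comp

theorem hasDerivAt_wronskian (h : IsRealSolution p l y y') {x : ℝ} (hx : x ∈ Ioo (0 : ℝ) 1)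
    (hpx : ContinuousAt p x) {v v' : ℝ → ℝ} {v'' : ℝ} (hv : HasDerivAt v (v' x) x)
    (hv' : HasDerivAt v' v'' x) :
    HasDerivAt (fun t => y' t * v t - y t * v' t) (-(y x * (l * p x * v x + v''))) x :=
  (((h.equation x hx hpx).mul hv).sub ((h.hasDerivAt hx).mul hv')).congr_deriv (by ring)

end IsRealSolution

end RealSolutionLemmas

/-- The real solution of `-y'' = l * p * y` that satisfies the boundary condition at `0`,
normalized by `y(0) = sin α` and `y'(0) = -cos α`. -/
structure IsLeftSolution (p : ℝ → ℝ) (α l : ℝ) (y y' : ℝ → ℝ) : Prop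
    extends IsRealSolution p l y y' where
  apply_zero : y 0 = Real.sin α
  deriv_apply_zero : y' 0 = -Real.cos α

namespace IsLeftSolution

variable {p : ℝ → ℝ} {α β l : ℝ} {y y' : ℝ → ℝ}

theorem exists_mem_Icc_ne_zero (h : IsLeftSolution p α l y y') : ∃ x ∈ Icc (0 : ℝ) 1, y x ≠ 0 := by
  by_contra! hzero
  have h0 : (0 : ℝ) ∈ Icc (0 : ℝ) 1 := left_mem_Icc.2 zero_le_one
  have hsin : Real.sin α = 0 := h.apply_zero ▸ hzero 0 h0
  have hderiv : y' 0 = 0 := Complex.ofReal_eq_zero.1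
    (h.ofReal.deriv_eq_zero (fun x hx => Complex.ofReal_eq_zero.2 (hzero x hx)) h0)
  have hcos : Real.cos α = 0 := neg_eq_zero.1 (h.deriv_apply_zero ▸ hderiv)
  simpa [hsin, hcos] using Real.sin_sq_add_cos_sq α

theorem deriv_ne_zero (h : IsLeftSolution p α l y y') (hp : IsCoefficient p) {x : ℝ}
    (hx : x ∈ Icc (0 : ℝ) 1) (hyx : y x = 0) : y' x ≠ 0 := by
  intro hyx'
  obtain ⟨t, ht, hne⟩ := h.exists_mem_Icc_ne_zero
  exact hne (Complex.ofReal_eq_zero.1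
    (h.ofReal.eq_zero hp hx (Complex.ofReal_eq_zero.2 hyx) (Complex.ofReal_eq_zero.2 hyx') t ht))

theorem isEigenvalue_iff (h : IsLeftSolution p α l y y') (hp : IsCoefficient p) :
    IsEigenvalue p α β (l : ℂ) ↔ y 1 * Real.cos β + y' 1 * Real.sin β = 0 := by
  constructor
  · rintro ⟨u, u', hu, h0, h1, x, hx, hne⟩
    obtain ⟨k, hk, hk'⟩ := exists_eq_mul_of_mul_add_mul_eq_zero h0
      (by exact_mod_cast Real.sin_sq_add_cos_sq α)
    have hdiff := hu.sub_const_mul h.ofReal k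
    have huy : ∀ t ∈ Icc (0 : ℝ) 1, u t - k * y t = 0 :=
      hdiff.eq_zero hp (left_mem_Icc.2 zero_le_one) (by simp [hk, h.apply_zero])
        (by simp [hk', h.deriv_apply_zero])
    have hu1 := huy 1 (right_mem_Icc.2 zero_le_one)
    have hu1' : u' 1 - k * y' 1 = 0 := hdiff.deriv_eq_zero huy (right_mem_Icc.2 zero_le_one)
    have hk0 : k ≠ 0 := by
      rintro rfl
      exact hne (by simpa using huy x hx)
    have hzero : k * (y 1 * Real.cos β + y' 1 * Real.sin β : ℂ) = 0 := by
      linear_combination h1 - Real.cos β * hu1 - Real.sin β * hu1'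
    exact_mod_cast (mul_eq_zero.1 hzero).resolve_left hk0
  · intro h1
    obtain ⟨x, hx, hne⟩ := h.exists_mem_Icc_ne_zero
    refine ⟨_, _, h.ofReal, ?_, by exact_mod_cast h1, x, hx, Complex.ofReal_ne_zero.2 hne⟩
    simp only [h.apply_zero, h.deriv_apply_zero]
    push_cast
    ring

theorem eventually_pos (h : IsLeftSolution p α l y y') (hα : α ∈ Ioc 0 Real.pi) :
    ∀ᶠ x in 𝓝[>] 0, 0 < y x := by
  have hIcc : Icc (0 : ℝ) 1 ∈ 𝓝[>] 0 := Icc_mem_nhdsGT zero_lt_one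
  rcases hα.2.lt_or_eq with hlt | rfl
  · refine nhdsWithin_le_of_mem hIcc
      ((h.continuousOn 0 (left_mem_Icc.2 zero_le_one)).eventually_const_lt ?_)
    rw [h.apply_zero]
    exact Real.sin_pos_of_pos_of_lt_pi hα.1 hlt
  · have hslope : Tendsto (slope y 0) (𝓝[>] 0) (𝓝 (y' 0)) :=
      (hasDerivWithinAt_iff_tendsto_slope' self_notMem_Ioi).1
        ((h.hasDeriv 0 (left_mem_Icc.2 zero_le_one)).mono_of_mem_nhdsWithin hIcc)
    have hpos : 0 < y' 0 := by simp [h.deriv_apply_zero]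
    filter_upwards [hslope.eventually_const_lt hpos, self_mem_nhdsWithin] with x hx hx0
    rw [slope_def_field, h.apply_zero, Real.sin_pi, sub_zero, sub_zero] at hx
    exact (div_pos_iff_of_pos_right hx0).1 hx

theorem pos_of_ne_zero (h : IsLeftSolution p α l y y') (hα : α ∈ Ioc 0 Real.pi)
    (hne : ∀ x ∈ Ioc (0 : ℝ) 1, y x ≠ 0) : ∀ x ∈ Ioc (0 : ℝ) 1, 0 < y x := by
  intro x hx
  by_contra! hle
  obtain ⟨w, hwpos, hw⟩ := ((h.eventually_pos hα).and (Ioc_mem_nhdsGT zero_lt_one)).exists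
  obtain ⟨z, hz, hyz⟩ := isPreconnected_Ioc.intermediate_value hx hw
    (h.continuousOn.mono Ioc_subset_Icc_self) ⟨hle, hwpos.le⟩
  exact hne z hz hyz

theorem exists_zero_of_pi_sq_le (h : IsLeftSolution p α l y y') (hp : IsCoefficient p)
    (hα : α ∈ Ioc 0 Real.pi) (hl : ∀ x ∈ Icc (0 : ℝ) 1, Real.pi ^ 2 ≤ l * p x) :
    ∃ x ∈ Ioc (0 : ℝ) 1, y x = 0 := by
  by_contra! hne
  have hpos := h.pos_of_ne_zero hα hne
  have hsin (x : ℝ) : HasDerivAt (fun t => Real.sin (Real.pi * t))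
      (Real.pi * Real.cos (Real.pi * x)) x :=
    (hasDerivAt_const_mul Real.pi).sin.congr_deriv (by ring)
  have hcos (x : ℝ) : HasDerivAt (fun t => Real.pi * Real.cos (Real.pi * t))
      (-(Real.pi ^ 2 * Real.sin (Real.pi * x))) x :=
    ((hasDerivAt_const_mul Real.pi).cos.const_mul Real.pi).congr_deriv (by ring)
  have hanti : AntitoneOn (fun x => y' x * Real.sin (Real.pi * x) -
      y x * (Real.pi * Real.cos (Real.pi * x))) (Icc 0 1) := by
    refine antitoneOn_of_hasDerivAt_nonpos_off_countable hp.countable_discontinuities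
      ((h.continuousOn_deriv.mul (by fun_prop)).sub (h.continuousOn.mul (by fun_prop)))
      (fun x hx hpx => h.hasDerivAt_wronskian hx hpx (hsin x) (hcos x)) fun x hx _ => ?_
    have hsin0 : 0 ≤ Real.sin (Real.pi * x) := Real.sin_nonneg_of_nonneg_of_le_pi
      (mul_nonneg Real.pi_pos.le hx.1.le) (mul_le_of_le_one_right Real.pi_pos.le hx.2.le)
    have hcoef : 0 ≤ (l * p x - Real.pi ^ 2) * Real.sin (Real.pi * x) :=
      mul_nonneg (sub_nonneg.2 (hl x (Ioo_subset_Icc_self hx))) hsin0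
    nlinarith [mul_nonneg (hpos x (Ioo_subset_Ioc_self hx)).le hcoef]
  have hends := hanti (left_mem_Icc.2 zero_le_one) (right_mem_Icc.2 zero_le_one) zero_le_one
  simp only [mul_zero, mul_one, Real.sin_zero, Real.cos_zero, Real.sin_pi, Real.cos_pi,
    h.apply_zero] at hends
  nlinarith [mul_pos Real.pi_pos (hpos 1 (right_mem_Ioc.2 zero_lt_one)),
    mul_nonneg Real.pi_pos.le (Real.sin_nonneg_of_nonneg_of_le_pi hα.1.le hα.2)]

/-- Comparison with a strict solution `q` of the Riccati inequality: `q` stays below `y' / y`. -/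
theorem mul_sub_riccati_pos (h : IsLeftSolution p α l y y') (hp : IsCoefficient p) {q q' : ℝ → ℝ}
    (hq : ∀ x, HasDerivAt q (q' x) x)
    (hriccati : ∀ x ∈ Ioo (0 : ℝ) 1, q' x + q x ^ 2 < -(l * p x))
    (h0 : 0 ≤ Real.sin α * (-Real.cos α - q 0 * Real.sin α)) :
    ∀ x ∈ Ioc (0 : ℝ) 1, 0 < y x * (y' x - q x * y x) := by
  have hmono : StrictMonoOn (fun x => y x * (y' x - q x * y x)) (Icc 0 1) := by
    have hqc : ContinuousOn q (Icc 0 1) := fun x _ => (hq x).continuousAt.continuousWithinAt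
    refine strictMonoOn_of_hasDerivAt_pos_off_countable hp.countable_discontinuities
      (f' := fun x => (y' x - q x * y x) ^ 2 + (-(l * p x) - (q' x + q x ^ 2)) * y x ^ 2)
      (h.continuousOn.mul (h.continuousOn_deriv.sub (hqc.mul h.continuousOn)))
      (fun x hx hpx => ?_) fun x hx _ => ?_
    · exact ((h.hasDerivAt hx).mul
        ((h.equation x hx hpx).sub ((hq x).mul (h.hasDerivAt hx)))).congr_deriv
          (by simp only [Pi.sub_apply, Pi.mul_apply]; ring)
    · have hgap := sub_pos.2 (hriccati x hx)
      by_cases hyx : y x = 0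
      · have hyx' : y' x ≠ 0 := h.deriv_ne_zero hp (Ioo_subset_Icc_self hx) hyx
        simpa [hyx] using sq_pos_of_ne_zero hyx'
      · positivity
  intro x hx
  refine lt_of_le_of_lt ?_ (hmono (left_mem_Icc.2 zero_le_one) (Ioc_subset_Icc_self hx) hx.1)
  simpa only [h.apply_zero, h.deriv_apply_zero] using h0

end IsLeftSolution

theorem eventually_atBot_isLeftSolution_pos {p : ℝ → ℝ} {α β : ℝ} (hp : IsWeight p)
    (hα : α ∈ Ioc 0 Real.pi) (hβ : β ∈ Ico 0 Real.pi) :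
    ∀ᶠ l in atBot, ∀ y y', IsLeftSolution p α l y y' →
      (∀ x ∈ Ioc (0 : ℝ) 1, 0 < y x) ∧ 0 < y 1 * Real.cos β + y' 1 * Real.sin β := by
  obtain ⟨m, hm, hmp⟩ := hp.bounded_away
  obtain ⟨A, hA⟩ : ∃ A : ℝ, Real.sin α * (-Real.cos α + A * Real.sin α) = 0 := by
    refine ⟨Real.cos α / Real.sin α, ?_⟩
    by_cases hs : Real.sin α = 0
    · simp [hs]
    · field_simp
      ring
  obtain ⟨B, hB⟩ : ∃ B : ℝ, Real.cos β + B * Real.sin β = 1 := by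
    rcases hβ.1.eq_or_lt with rfl | hβ0
    · exact ⟨0, by simp⟩
    · have hs := Real.sin_pos_of_pos_of_lt_pi hβ0 hβ.2
      exact ⟨(1 - Real.cos β) / Real.sin β, by field_simp; ring⟩
  -- Riccati comparison with the chord from `-A` to `B`: it starts at the logarithmic derivative
  -- `-cot α` of `y`, and a solution that ends above slope `B` has a positive boundary form.
  have hq (x : ℝ) : HasDerivAt (fun t => -A + (A + B) * t) (A + B) x :=
    (hasDerivAt_const_mul (A + B)).const_add (-A)
  filter_upwards [eventually_le_atBot 0, eventually_lt_atBot (-(A + B + A ^ 2 + B ^ 2) / m)]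
    with l hl0 hl y y' h
  rw [lt_div_iff₀ hm] at hl
  have hriccati : ∀ x ∈ Ioo (0 : ℝ) 1, A + B + (-A + (A + B) * x) ^ 2 < -(l * p x) := by
    intro x hx
    have hconvex : (-A + (A + B) * x) ^ 2 ≤ A ^ 2 + B ^ 2 := by
      nlinarith [mul_nonneg hx.1.le (sq_nonneg A), mul_nonneg (sub_nonneg.2 hx.2.le) (sq_nonneg B),
        mul_nonneg (mul_nonneg hx.1.le (sub_nonneg.2 hx.2.le)) (sq_nonneg (A + B))]
    have hlp := mul_le_mul_of_nonpos_left (hmp x (Ioo_subset_Icc_self hx)) hl0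
    linarith
  have hE := h.mul_sub_riccati_pos hp.toIsCoefficient hq hriccati (by linarith)
  have hpos := h.pos_of_ne_zero hα fun x hx hyx => (hE x hx).ne' (by simp [hyx])
  refine ⟨hpos, ?_⟩
  have h1 := right_mem_Ioc.2 (zero_lt_one' ℝ)
  have hslope : B * y 1 < y' 1 := by linarith [(mul_pos_iff_of_pos_left (hpos 1 h1)).1 (hE 1 h1)]
  nlinarith [hpos 1 h1, mul_nonneg (Real.sin_nonneg_of_nonneg_of_le_pi hβ.1 hβ.2.le)
    (sub_nonneg.2 hslope.le)]

namespace IsRealSolution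

variable {p : ℝ → ℝ} {l : ℝ} {y y' : ℝ → ℝ}

theorem nonneg_of_nonneg_Ioo (h : IsRealSolution p l y y') (hy : ∀ x ∈ Ioo (0 : ℝ) 1, 0 ≤ y x) :
    ∀ x ∈ Icc (0 : ℝ) 1, 0 ≤ y x := by
  have hcl : closure (Ioo (0 : ℝ) 1) = Icc 0 1 := closure_Ioo zero_ne_one
  exact fun x hx => le_on_closure hy continuousOn_const (hcl ▸ h.continuousOn) (hcl ▸ hx)

theorem deriv_one_nonpos (h : IsRealSolution p l y y') (hy : ∀ x ∈ Icc (0 : ℝ) 1, 0 ≤ y x)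
    (h1 : y 1 = 0) : y' 1 ≤ 0 := by
  have h1I : (1 : ℝ) ∈ Icc (0 : ℝ) 1 := right_mem_Icc.2 zero_le_one
  have hmin : IsLocalMinOn y (Icc 0 1) 1 :=
    eventually_nhdsWithin_of_forall fun x hx => h1.symm ▸ hy x hx
  have hcone : (0 : ℝ) - 1 ∈ posTangentConeAt (Icc (0 : ℝ) 1) 1 :=
    sub_mem_posTangentConeAt_of_segment_subset
      ((convex_Icc 0 1).segment_subset h1I (left_mem_Icc.2 zero_le_one))
  simpa using hmin.hasFDerivWithinAt_nonneg (h.hasDeriv 1 h1I).hasFDerivWithinAt hcone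

end IsRealSolution

/-- The jointly continuous family of the solutions `IsLeftSolution`, one for each parameter `l`. -/
structure IsShootingFamily (p : ℝ → ℝ) (α : ℝ) (y y' : ℝ → ℝ → ℝ) : Prop where
  continuous : Continuous ↿y
  continuous_deriv : Continuous ↿y'
  isLeftSolution : ∀ l, IsLeftSolution p α l (y l) (y' l)

theorem exists_isShootingFamily {p : ℝ → ℝ} (hp : IsCoefficient p) (α : ℝ) :
    ∃ y y', IsShootingFamily p α y y' := by
  obtain ⟨y, y', hy, hy', hsol⟩ :=
    exists_continuous_solution_family hp (Real.sin α) (-Real.cos α)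
  exact ⟨y, y', hy, hy', fun l => ⟨(hsol l).1, (hsol l).2.1, (hsol l).2.2⟩⟩

/-- The boundary form at `1` of a shooting family; its zeros are the real eigenvalues. -/
noncomputable def characteristicFunction (β : ℝ) (y y' : ℝ → ℝ → ℝ) (l : ℝ) : ℝ :=
  y l 1 * Real.cos β + y' l 1 * Real.sin β

/-- The parameters of a shooting family for which the solution has a zero in `(0, 1]`. -/
def vanishingParameters (y : ℝ → ℝ → ℝ) : Set ℝ :=
  {l | ∃ x ∈ Ioc (0 : ℝ) 1, y l x = 0}

namespace IsShootingFamily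

variable {p : ℝ → ℝ} {α β k l : ℝ} {y y' : ℝ → ℝ → ℝ}

theorem continuous_characteristicFunction (h : IsShootingFamily p α y y') (β : ℝ) :
    Continuous (characteristicFunction β y y') :=
  ((h.continuous.comp (by fun_prop : Continuous fun l : ℝ => (l, (1 : ℝ)))).mul_const _).add
    ((h.continuous_deriv.comp (by fun_prop : Continuous fun l : ℝ => (l, (1 : ℝ)))).mul_const _)

theorem nonempty_vanishingParameters (h : IsShootingFamily p α y y') (hp : IsWeight p)
    (hα : α ∈ Ioc 0 Real.pi) : (vanishingParameters y).Nonempty := by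
  obtain ⟨m, hm, hmp⟩ := hp.bounded_away
  refine ⟨Real.pi ^ 2 / m, (h.isLeftSolution _).exists_zero_of_pi_sq_le hp.toIsCoefficient hα
    fun x hx => ?_⟩
  calc Real.pi ^ 2 = Real.pi ^ 2 / m * m := (div_mul_cancel₀ _ hm.ne').symm
    _ ≤ Real.pi ^ 2 / m * p x := by
      gcongr
      exact hmp x hx

theorem bddBelow_vanishingParameters (h : IsShootingFamily p α y y') (hp : IsWeight p)
    (hα : α ∈ Ioc 0 Real.pi) : BddBelow (vanishingParameters y) := by
  obtain ⟨b, hb⟩ := eventually_atBot.1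
    (eventually_atBot_isLeftSolution_pos hp hα (left_mem_Ico.2 Real.pi_pos))
  refine ⟨b, fun l ⟨x, hx, hyx⟩ => ?_⟩
  by_contra! hlt
  exact ((hb l hlt.le _ _ (h.isLeftSolution l)).1 x hx).ne' hyx

theorem isClosed_vanishingParameters (h : IsShootingFamily p α y y') (hp : IsCoefficient p) :
    IsClosed (vanishingParameters y) := by
  refine IsSeqClosed.isClosed fun ls l hzero hls => ?_
  choose xs hxs hyxs using hzero
  obtain ⟨x, hx, φ, hφ, hxlim⟩ :=
    isCompact_Icc.tendsto_subseq fun n => Ioc_subset_Icc_self (hxs n)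
  have hllim : Tendsto (ls ∘ φ) atTop (𝓝 l) := hls.comp hφ.tendsto_atTop
  have hyx : y l x = 0 := tendsto_nhds_unique
    ((h.continuous.tendsto (l, x)).comp (hllim.prodMk_nhds hxlim))
    (tendsto_const_nhds.congr fun n => (hyxs (φ n)).symm)
  rcases hx.1.lt_or_eq with hx0 | rfl
  · exact ⟨x, ⟨hx0, hx.2⟩, hyx⟩
  -- Zeros accumulating at `0`, where the solutions vanish too, would force `y l` to be flat there.
  have hrolle : ∀ n, ∃ t ∈ Ioo 0 (xs n), y' (ls n) t = 0 := fun n =>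
    exists_hasDerivAt_eq_zero (hxs n).1
      ((h.isLeftSolution (ls n)).continuousOn.mono (Icc_subset_Icc_right (hxs n).2))
      (by rw [hyxs, (h.isLeftSolution (ls n)).apply_zero, ← (h.isLeftSolution l).apply_zero, hyx])
      fun t ht => (h.isLeftSolution (ls n)).hasDerivAt ⟨ht.1, ht.2.trans_le (hxs n).2⟩
  choose ts hts hyts using hrolle
  have htlim : Tendsto (ts ∘ φ) atTop (𝓝 0) :=
    tendsto_of_tendsto_of_tendsto_of_le_of_le tendsto_const_nhds hxlim
      (fun n => (hts (φ n)).1.le) fun n => (hts (φ n)).2.le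
  have hyx' : y' l 0 = 0 := tendsto_nhds_unique
    ((h.continuous_deriv.tendsto (l, 0)).comp (hllim.prodMk_nhds htlim))
    (tendsto_const_nhds.congr fun n => (hyts (φ n)).symm)
  exact absurd hyx' ((h.isLeftSolution l).deriv_ne_zero hp hx hyx)

theorem exists_isLeast_vanishingParameters (h : IsShootingFamily p α y y') (hp : IsWeight p)
    (hα : α ∈ Ioc 0 Real.pi) : ∃ k, IsLeast (vanishingParameters y) k :=
  ⟨_, (h.isClosed_vanishingParameters hp.toIsCoefficient).isLeast_csInf
    (h.nonempty_vanishingParameters hp hα) (h.bddBelow_vanishingParameters hp hα)⟩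

theorem pos_of_lt_isLeast (h : IsShootingFamily p α y y') (hα : α ∈ Ioc 0 Real.pi)
    (hk : IsLeast (vanishingParameters y) k) (hl : l < k) : ∀ x ∈ Ioc (0 : ℝ) 1, 0 < y l x :=
  (h.isLeftSolution l).pos_of_ne_zero hα fun x hx hyx => hl.not_ge (hk.2 ⟨x, hx, hyx⟩)

theorem pos_of_le_isLeast (h : IsShootingFamily p α y y') (hp : IsCoefficient p)
    (hα : α ∈ Ioc 0 Real.pi) (hk : IsLeast (vanishingParameters y) k) (hl : l ≤ k) :
    ∀ x ∈ Ioo (0 : ℝ) 1, 0 < y l x := by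
  rcases hl.lt_or_eq with hlt | rfl
  · exact fun x hx => h.pos_of_lt_isLeast hα hk hlt x (Ioo_subset_Ioc_self hx)
  have hnonneg : ∀ x ∈ Ioo (0 : ℝ) 1, 0 ≤ y l x := by
    intro x hx
    have hcont : Continuous fun m : ℝ => y m x :=
      h.continuous.comp (by fun_prop : Continuous fun m : ℝ => (m, x))
    refine ge_of_tendsto (hcont.continuousWithinAt (s := Iio l) (x := l)) ?_
    filter_upwards [self_mem_nhdsWithin] with m hm
    exact (h.pos_of_lt_isLeast hα hk hm x (Ioo_subset_Ioc_self hx)).le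
  intro x hx
  refine (hnonneg x hx).lt_of_ne' fun hyx => ?_
  have hmin : IsLocalMin (y l) x := by
    filter_upwards [Ioo_mem_nhds hx.1 hx.2] with t ht
    exact hyx ▸ hnonneg t ht
  exact (h.isLeftSolution l).deriv_ne_zero hp (Ioo_subset_Icc_self hx) hyx
    (hmin.hasDerivAt_eq_zero ((h.isLeftSolution l).hasDerivAt hx))

theorem characteristicFunction_nonpos (h : IsShootingFamily p α y y') (hp : IsCoefficient p)
    (hα : α ∈ Ioc 0 Real.pi) (hβ : β ∈ Ico 0 Real.pi) (hk : IsLeast (vanishingParameters y) k) :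
    characteristicFunction β y y' k ≤ 0 := by
  have hpos := h.pos_of_le_isLeast hp hα hk le_rfl
  have hy1 : y k 1 = 0 := by
    obtain ⟨x, hx, hyx⟩ := hk.1
    rcases hx.2.lt_or_eq with hx1 | rfl
    · exact absurd hyx (hpos x ⟨hx.1, hx1⟩).ne'
    · exact hyx
  have hy1' : y' k 1 ≤ 0 := (h.isLeftSolution k).deriv_one_nonpos
    ((h.isLeftSolution k).nonneg_of_nonneg_Ioo fun x hx => (hpos x hx).le) hy1
  rw [characteristicFunction, hy1, zero_mul, zero_add]
  exact mul_nonpos_of_nonpos_of_nonneg hy1' (Real.sin_nonneg_of_nonneg_of_le_pi hβ.1 hβ.2.le)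

theorem exists_forall_le_characteristicFunction_pos (h : IsShootingFamily p α y y')
    (hp : IsWeight p) (hα : α ∈ Ioc 0 Real.pi) (hβ : β ∈ Ico 0 Real.pi) :
    ∃ b, ∀ l ≤ b, 0 < characteristicFunction β y y' l := by
  obtain ⟨b, hb⟩ := eventually_atBot.1 (eventually_atBot_isLeftSolution_pos hp hα hβ)
  exact ⟨b, fun l hl => (hb l hl _ _ (h.isLeftSolution l)).2⟩

theorem exists_le_characteristicFunction_eq_zero (h : IsShootingFamily p α y y')
    (hp : IsWeight p) (hα : α ∈ Ioc 0 Real.pi) (hβ : β ∈ Ico 0 Real.pi)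
    (hk : IsLeast (vanishingParameters y) k) :
    ∃ l ≤ k, characteristicFunction β y y' l = 0 := by
  obtain ⟨b, hb⟩ := h.exists_forall_le_characteristicFunction_pos hp hα hβ
  have hFk := h.characteristicFunction_nonpos hp.toIsCoefficient hα hβ hk
  have hbk : b ≤ k := by
    by_contra! hkb
    exact (hb k hkb.le).not_ge hFk
  obtain ⟨l, hl, hFl⟩ := intermediate_value_Icc' hbk
    (h.continuous_characteristicFunction β).continuousOn ⟨hFk, (hb b le_rfl).le⟩
  exact ⟨l, hl.2, hFl⟩

theorem setOf_isEigenvalue_eq (h : IsShootingFamily p α y y') (hp : IsCoefficient p) (β : ℝ) :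
    {l : ℝ | IsEigenvalue p α β (l : ℂ)} = characteristicFunction β y y' ⁻¹' {0} :=
  ext fun l => (h.isLeftSolution l).isEigenvalue_iff hp

end IsShootingFamily

section LowestEigenvalue

variable {p : ℝ → ℝ} {α β : ℝ}

theorem isLeast_lowestEigenvalue (hp : IsWeight p) (hα : α ∈ Ioc 0 Real.pi)
    (hβ : β ∈ Ico 0 Real.pi) :
    IsLeast {l : ℝ | IsEigenvalue p α β (l : ℂ)} (lowestEigenvalue p α β) := by
  obtain ⟨y, y', h⟩ := exists_isShootingFamily hp.toIsCoefficient α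
  obtain ⟨k, hk⟩ := h.exists_isLeast_vanishingParameters hp hα
  obtain ⟨l, -, hl⟩ := h.exists_le_characteristicFunction_eq_zero hp hα hβ hk
  obtain ⟨b, hb⟩ := h.exists_forall_le_characteristicFunction_pos hp hα hβ
  rw [lowestEigenvalue, h.setOf_isEigenvalue_eq hp.toIsCoefficient]
  refine (isClosed_singleton.preimage (h.continuous_characteristicFunction β)).isLeast_csInf
    ⟨l, hl⟩ ⟨b, fun m hm => ?_⟩
  by_contra! hmb
  exact (hb m hmb.le).ne' hm

/-- An eigenfunction for `l` that is positive on `(0, 1)`, normalized as in `IsLeftSolution`. -/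
structure IsGroundState (p : ℝ → ℝ) (α β l : ℝ) (y y' : ℝ → ℝ) : Prop
    extends IsLeftSolution p α l y y' where
  boundary_one : y 1 * Real.cos β + y' 1 * Real.sin β = 0
  pos : ∀ x ∈ Ioo (0 : ℝ) 1, 0 < y x

theorem exists_isGroundState (hp : IsWeight p) (hα : α ∈ Ioc 0 Real.pi)
    (hβ : β ∈ Ico 0 Real.pi) : ∃ y y', IsGroundState p α β (lowestEigenvalue p α β) y y' := by
  obtain ⟨y, y', h⟩ := exists_isShootingFamily hp.toIsCoefficient α
  obtain ⟨k, hk⟩ := h.exists_isLeast_vanishingParameters hp hα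
  obtain ⟨heig, hleast⟩ := isLeast_lowestEigenvalue hp hα hβ
  have hle : lowestEigenvalue p α β ≤ k := by
    obtain ⟨l, hlk, hl⟩ := h.exists_le_characteristicFunction_eq_zero hp hα hβ hk
    exact (hleast (((h.isLeftSolution l).isEigenvalue_iff hp.toIsCoefficient).2 hl)).trans hlk
  have hsol := h.isLeftSolution (lowestEigenvalue p α β)
  exact ⟨_, _, hsol, (hsol.isEigenvalue_iff hp.toIsCoefficient).1 heig,
    h.pos_of_le_isLeast hp.toIsCoefficient hα hk hle⟩

end LowestEigenvalue

section Trigonometry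

variable {α β : ℝ}

theorem sin_sub_cos_eq (α : ℝ) :
    Real.sin α - Real.cos α = √2 * Real.sin (α - Real.pi / 4) := by
  rw [Real.sin_sub, Real.cos_pi_div_four, Real.sin_pi_div_four]
  linear_combination -(Real.sin α - Real.cos α) / 2 * Real.sq_sqrt (zero_le_two (α := ℝ))

theorem cos_le_sin_iff (hα : α ∈ Ioc 0 Real.pi) :
    Real.cos α ≤ Real.sin α ↔ Real.pi / 4 ≤ α := by
  rw [← sub_nonneg, sin_sub_cos_eq, mul_nonneg_iff_of_pos_left (by positivity)]
  refine ⟨fun h => ?_, fun h => Real.sin_nonneg_of_nonneg_of_le_pi (by linarith)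
    (by linarith [hα.2, Real.pi_pos])⟩
  by_contra! hlt
  exact (Real.sin_neg_of_neg_of_neg_pi_lt (by linarith) (by linarith [hα.1, Real.pi_pos])).not_ge h

theorem cos_lt_sin_iff (hα : α ∈ Ioc 0 Real.pi) :
    Real.cos α < Real.sin α ↔ Real.pi / 4 < α := by
  rw [← sub_pos, sin_sub_cos_eq, mul_pos_iff_of_pos_left (by positivity)]
  refine ⟨fun h => ?_, fun h => Real.sin_pos_of_pos_of_lt_pi (by linarith)
    (by linarith [hα.2, Real.pi_pos])⟩
  by_contra! hle
  exact (Real.sin_nonpos_of_nonpos_of_neg_pi_le (by linarith)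
    (by linarith [hα.1, Real.pi_pos])).not_gt h

theorem cos_add_sin_nonneg_iff (hβ : β ∈ Ico 0 Real.pi) :
    0 ≤ Real.cos β + Real.sin β ↔ β ≤ 3 * Real.pi / 4 := by
  have h := cos_le_sin_iff (α := Real.pi - β) ⟨by linarith [hβ.2], by linarith [hβ.1]⟩
  rw [Real.cos_pi_sub, Real.sin_pi_sub, neg_le_iff_add_nonneg'] at h
  rw [h]
  constructor <;> intro <;> linarith

theorem cos_add_sin_pos_iff (hβ : β ∈ Ico 0 Real.pi) :
    0 < Real.cos β + Real.sin β ↔ β < 3 * Real.pi / 4 := by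
  have h := cos_lt_sin_iff (α := Real.pi - β) ⟨by linarith [hβ.2], by linarith [hβ.1]⟩
  rw [Real.cos_pi_sub, Real.sin_pi_sub, neg_lt_iff_pos_add'] at h
  rw [h]
  constructor <;> intro <;> linarith

theorem cos_mul_cos_sub_sin_sub_eq (α β : ℝ) :
    Real.cos α * Real.cos β - Real.sin (α - β) = Real.sin α * Real.sin β -
      (Real.sin α - Real.cos α) * (Real.cos β + Real.sin β) := by
  rw [Real.sin_sub]
  ring

theorem sin_sub_mul_cos_pos (hα : α ∈ Ioc 0 Real.pi) (hcs : Real.cos α ≤ Real.sin α) {x : ℝ}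
    (hx : x ∈ Ioo (0 : ℝ) 1) : 0 < Real.sin α - x * Real.cos α := by
  rcases hα.2.lt_or_eq with hlt | rfl
  · nlinarith [mul_pos (sub_pos.2 hx.2) (Real.sin_pos_of_pos_of_lt_pi hα.1 hlt),
      mul_nonneg hx.1.le (sub_nonneg.2 hcs)]
  · simpa using hx.1

theorem cos_add_sin_nonneg_of_le (hα : α ∈ Ioc 0 Real.pi) (hβ : β ∈ Ico 0 Real.pi)
    (hcs : Real.cos α ≤ Real.sin α) (h : Real.cos α * Real.cos β - Real.sin (α - β) ≤ 0) :
    0 ≤ Real.cos β + Real.sin β := by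
  by_contra! hneg
  have hβ0 : 0 < β := hβ.1.lt_of_ne' (by rintro rfl; norm_num at hneg)
  have hsinβ : 0 < Real.sin β := Real.sin_pos_of_pos_of_lt_pi hβ0 hβ.2
  have hsinα : 0 ≤ Real.sin α := Real.sin_nonneg_of_nonneg_of_le_pi hα.1.le hα.2
  rw [cos_mul_cos_sub_sin_sub_eq] at h
  have hprod : (Real.sin α - Real.cos α) * (Real.cos β + Real.sin β) ≤ 0 :=
    mul_nonpos_of_nonneg_of_nonpos (sub_nonneg.2 hcs) hneg.le
  have hsinα0 : Real.sin α = 0 := by nlinarith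
  have hcosα0 : Real.cos α = 0 := by
    rw [hsinα0] at h hcs
    nlinarith
  simpa [hsinα0, hcosα0] using Real.sin_sq_add_cos_sq α

theorem onCurve_iff (hα : α ∈ Ioc 0 Real.pi) (hβ : β ∈ Ico 0 Real.pi) :
    OnCurve α β ↔
      Real.cos α ≤ Real.sin α ∧ Real.cos α * Real.cos β - Real.sin (α - β) = 0 := by
  constructor
  · rintro ⟨hα', -, h⟩
    exact ⟨(cos_le_sin_iff hα).2 hα'.1, h⟩
  · rintro ⟨hcs, h⟩
    exact ⟨⟨(cos_le_sin_iff hα).1 hcs, hα.2⟩,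
      ⟨hβ.1, (cos_add_sin_nonneg_iff hβ).1 (cos_add_sin_nonneg_of_le hα hβ hcs h.le)⟩, h⟩

theorem inPositiveRegion_iff (hα : α ∈ Ioc 0 Real.pi) (hβ : β ∈ Ico 0 Real.pi) :
    InPositiveRegion α β ↔
      Real.cos α ≤ Real.sin α ∧ Real.cos α * Real.cos β - Real.sin (α - β) < 0 := by
  constructor
  · rintro ⟨hα', -, h⟩
    exact ⟨(cos_le_sin_iff hα).2 hα'.1.le, h⟩
  · rintro ⟨hcs, h⟩
    have hprod : 0 < (Real.sin α - Real.cos α) * (Real.cos β + Real.sin β) := by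
      linarith [cos_mul_cos_sub_sin_sub_eq α β,
        mul_nonneg (Real.sin_nonneg_of_nonneg_of_le_pi hα.1.le hα.2)
          (Real.sin_nonneg_of_nonneg_of_le_pi hβ.1 hβ.2.le)]
    have hcs' : Real.cos α < Real.sin α := sub_pos.1
      (pos_of_mul_pos_left hprod (cos_add_sin_nonneg_of_le hα hβ hcs h.le))
    have hβ' : 0 < Real.cos β + Real.sin β := pos_of_mul_pos_right hprod (sub_nonneg.2 hcs)
    exact ⟨⟨(cos_lt_sin_iff hα).1 hcs', hα.2⟩, ⟨hβ.1, (cos_add_sin_pos_iff hβ).1 hβ'⟩, h⟩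

end Trigonometry

/-- The Wronskian of `y` and of the solution `x ↦ sin α - x cos α` for the parameter `0`. -/
noncomputable def linearWronskian (α : ℝ) (y y' : ℝ → ℝ) (x : ℝ) : ℝ :=
  y' x * (Real.sin α - x * Real.cos α) - y x * -Real.cos α

namespace IsGroundState

variable {p : ℝ → ℝ} {α β l : ℝ} {y y' : ℝ → ℝ}

theorem nonneg (h : IsGroundState p α β l y y') : ∀ x ∈ Icc (0 : ℝ) 1, 0 ≤ y x :=
  h.nonneg_of_nonneg_Ioo fun x hx => (h.pos x hx).le

theorem exists_pos_boundary_one (h : IsGroundState p α β l y y') (hp : IsCoefficient p)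
    (hβ : β ∈ Ico 0 Real.pi) :
    ∃ c > 0, y 1 = c * Real.sin β ∧ y' 1 = -(c * Real.cos β) := by
  have h1 : (1 : ℝ) ∈ Icc (0 : ℝ) 1 := right_mem_Icc.2 zero_le_one
  obtain ⟨c, hy, hy'⟩ :=
    exists_eq_mul_of_mul_add_mul_eq_zero h.boundary_one (Real.sin_sq_add_cos_sq β)
  have hc : c ≠ 0 := by
    rintro rfl
    exact h.deriv_ne_zero hp h1 (by simpa using hy) (by simpa using hy')
  refine ⟨c, hc.symm.lt_of_le ?_, hy, hy'⟩
  rcases hβ.1.eq_or_lt with rfl | hβ0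
  · simpa [hy'] using h.deriv_one_nonpos h.nonneg (by simpa using hy)
  · exact nonneg_of_mul_nonneg_left (hy ▸ h.nonneg 1 h1) (Real.sin_pos_of_pos_of_lt_pi hβ0 hβ.2)

theorem lt_zero_of_sin_lt_cos (h : IsGroundState p α β l y y') (hp : IsWeight p)
    (hcs : Real.sin α < Real.cos α) : l < 0 := by
  by_contra! hl
  have h0 : (0 : ℝ) ∈ Icc (0 : ℝ) 1 := left_mem_Icc.2 zero_le_one
  have h1 : (1 : ℝ) ∈ Icc (0 : ℝ) 1 := right_mem_Icc.2 zero_le_one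
  have hconcave : AntitoneOn y' (Icc 0 1) :=
    antitoneOn_of_hasDerivAt_nonpos_off_countable hp.countable_discontinuities
      h.continuousOn_deriv h.equation fun x hx _ => neg_nonpos.2
        (mul_nonneg (mul_nonneg hl (hp.pos (Ioo_subset_Icc_self hx)).le) (h.pos x hx).le)
  have htangent : AntitoneOn (fun x => y x + Real.cos α * x) (Icc 0 1) := by
    refine antitoneOn_of_hasDerivAt_nonpos_off_countable hp.countable_discontinuities
      (h.continuousOn.add (by fun_prop))
      (fun x hx _ => (h.hasDerivAt hx).add (hasDerivAt_const_mul (Real.cos α))) fun x hx _ => ?_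
    have hle := hconcave h0 (Ioo_subset_Icc_self hx) hx.1.le
    rw [h.deriv_apply_zero] at hle
    linarith
  have hends := htangent h0 h1 zero_le_one
  simp only [h.apply_zero, mul_one, mul_zero, add_zero] at hends
  linarith [h.nonneg 1 h1]

theorem continuousOn_linearWronskian (h : IsGroundState p α β l y y') :
    ContinuousOn (linearWronskian α y y') (Icc 0 1) :=
  (h.continuousOn_deriv.mul (by fun_prop)).sub (h.continuousOn.mul (by fun_prop))

theorem hasDerivAt_linearWronskian (h : IsGroundState p α β l y y') {x : ℝ}
    (hx : x ∈ Ioo (0 : ℝ) 1) (hpx : ContinuousAt p x) :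
    HasDerivAt (linearWronskian α y y')
      (-(l * (p x * y x * (Real.sin α - x * Real.cos α)))) x :=
  (h.hasDerivAt_wronskian hx hpx (v' := fun _ => -Real.cos α)
    ((hasDerivAt_mul_const (Real.cos α)).const_sub _) (hasDerivAt_const x _)).congr_deriv (by ring)

theorem linearWronskian_zero (h : IsGroundState p α β l y y') :
    linearWronskian α y y' 0 = 0 := by
  rw [linearWronskian, h.apply_zero, h.deriv_apply_zero]
  ring

theorem exists_pos_linearWronskian_one (h : IsGroundState p α β l y y') (hp : IsCoefficient p)
    (hβ : β ∈ Ico 0 Real.pi) :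
    ∃ c > 0, linearWronskian α y y' 1 =
      c * (Real.cos α * Real.cos β - Real.sin (α - β)) := by
  obtain ⟨c, hc, hy, hy'⟩ := h.exists_pos_boundary_one hp hβ
  refine ⟨c, hc, ?_⟩
  rw [linearWronskian, hy, hy', Real.sin_sub]
  ring

theorem sign_linearWronskian_one (h : IsGroundState p α β l y y') (hp : IsWeight p)
    (hα : α ∈ Ioc 0 Real.pi) (hcs : Real.cos α ≤ Real.sin α) :
    SignType.sign (linearWronskian α y y' 1) = SignType.sign (-l) := by
  have h0 : (0 : ℝ) ∈ Icc (0 : ℝ) 1 := left_mem_Icc.2 zero_le_one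
  have h1 : (1 : ℝ) ∈ Icc (0 : ℝ) 1 := right_mem_Icc.2 zero_le_one
  have hweight : ∀ x ∈ Ioo (0 : ℝ) 1, 0 < p x * y x * (Real.sin α - x * Real.cos α) :=
    fun x hx => mul_pos (mul_pos (hp.pos (Ioo_subset_Icc_self hx)) (h.pos x hx))
      (sin_sub_mul_cos_pos hα hcs hx)
  rcases eq_or_ne l 0 with rfl | hl
  · have hle := monotoneOn_of_hasDerivAt_nonneg_off_countable hp.countable_discontinuities
      h.continuousOn_linearWronskian (fun x hx => h.hasDerivAt_linearWronskian hx)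
      (fun x _ _ => by simp) h0 h1 zero_le_one
    have hge := antitoneOn_of_hasDerivAt_nonpos_off_countable hp.countable_discontinuities
      h.continuousOn_linearWronskian (fun x hx => h.hasDerivAt_linearWronskian hx)
      (fun x _ _ => by simp) h0 h1 zero_le_one
    rw [le_antisymm hge hle, h.linearWronskian_zero, neg_zero]
  · have hlt := lt_of_hasDerivAt_pos_off_countable hp.countable_discontinuities zero_lt_one
      (f := fun x => -l * linearWronskian α y y' x)
      (continuousOn_const.mul h.continuousOn_linearWronskian)
      (fun x hx hpx => (h.hasDerivAt_linearWronskian hx hpx).const_mul (-l)) fun x hx _ => by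
        nlinarith [mul_pos (sq_pos_of_ne_zero hl) (hweight x hx)]
    rw [h.linearWronskian_zero, mul_zero] at hlt
    rcases pos_and_pos_or_neg_and_neg_of_mul_pos hlt with ⟨hl', hW⟩ | ⟨hl', hW⟩
    · rw [sign_pos hl', sign_pos hW]
    · rw [sign_neg hl', sign_neg hW]

theorem sign_boundary_determinant (h : IsGroundState p α β l y y') (hp : IsWeight p)
    (hα : α ∈ Ioc 0 Real.pi) (hβ : β ∈ Ico 0 Real.pi) (hcs : Real.cos α ≤ Real.sin α) :
    SignType.sign (Real.cos α * Real.cos β - Real.sin (α - β)) = SignType.sign (-l) := by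
  obtain ⟨c, hc, hW⟩ := h.exists_pos_linearWronskian_one hp.toIsCoefficient hβ
  rw [← h.sign_linearWronskian_one hp hα hcs, hW, sign_mul, sign_pos hc, one_mul]

theorem sign_iff (h : IsGroundState p α β l y y') (hp : IsWeight p) (hα : α ∈ Ioc 0 Real.pi)
    (hβ : β ∈ Ico 0 Real.pi) :
    (l = 0 ↔ OnCurve α β) ∧ (0 < l ↔ InPositiveRegion α β) := by
  rw [onCurve_iff hα hβ, inPositiveRegion_iff hα hβ]
  rcases le_or_gt (Real.cos α) (Real.sin α) with hcs | hcs
  · have hsign := h.sign_boundary_determinant hp hα hβ hcs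
    rw [← sign_eq_zero_iff (a := Real.cos α * _ - _), ← sign_eq_neg_one_iff, hsign,
      sign_eq_zero_iff, sign_eq_neg_one_iff, neg_eq_zero, neg_lt_zero]
    simp only [hcs, true_and, and_self]
  · have hl := h.lt_zero_of_sin_lt_cos hp hcs
    simp only [hcs.not_ge, hl.ne, hl.not_gt, false_and, and_self]

end IsGroundState

end VibratingString

theorem theorem3p3_general (p : ℝ → ℝ) (hp : VibratingString.IsWeight p) (α β : ℝ)
    (hα : α ∈ Set.Ioc 0 Real.pi) (hβ : β ∈ Set.Ico 0 Real.pi) :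
    (VibratingString.IsEigenvalue p α β (VibratingString.lowestEigenvalue p α β : ℂ) ∧
      ∀ μ : ℂ, VibratingString.IsEigenvalue p α β μ →
        μ.im = 0 ∧ VibratingString.lowestEigenvalue p α β ≤ μ.re) ∧
    (VibratingString.lowestEigenvalue p α β = 0 ↔ VibratingString.OnCurve α β) ∧
    (0 < VibratingString.lowestEigenvalue p α β ↔ VibratingString.InPositiveRegion α β) ∧
    (VibratingString.lowestEigenvalue p α β < 0 ↔
      ¬ VibratingString.OnCurve α β ∧ ¬ VibratingString.InPositiveRegion α β) := by
  obtain ⟨heig, hleast⟩ := VibratingString.isLeast_lowestEigenvalue hp hα hβ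
  obtain ⟨y, y', hground⟩ := VibratingString.exists_isGroundState hp hα hβ
  obtain ⟨hzero, hpos⟩ := hground.sign_iff hp hα hβ
  refine ⟨⟨heig, fun μ hμ => ?_⟩, hzero, hpos, ?_⟩
  · have hreal : (μ.re : ℂ) = μ := Complex.ext rfl (hμ.im_eq_zero hp).symm
    exact ⟨hμ.im_eq_zero hp, hleast (hreal.symm ▸ hμ)⟩
  · rw [← hzero, ← hpos, not_lt, and_comm, ← lt_iff_le_and_ne]

theorem theorem3p3 (p : ℝ → ℝ) (hp : VibratingString.IsDensity p) (α β : ℝ)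
    (hα : α ∈ Set.Ioc 0 Real.pi) (hβ : β ∈ Set.Ico 0 Real.pi) :
    -- `λ₀` is the lowest eigenvalue: it is an eigenvalue, and every eigenvalue is real and `≥ λ₀`
    (VibratingString.IsEigenvalue p α β (VibratingString.lowestEigenvalue p α β : ℂ) ∧
      ∀ μ : ℂ, VibratingString.IsEigenvalue p α β μ →
        μ.im = 0 ∧ VibratingString.lowestEigenvalue p α β ≤ μ.re) ∧
    -- its sign
    (VibratingString.lowestEigenvalue p α β = 0 ↔ VibratingString.OnCurve α β) ∧
    (0 < VibratingString.lowestEigenvalue p α β ↔ VibratingString.InPositiveRegion α β) ∧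
    (VibratingString.lowestEigenvalue p α β < 0 ↔
      ¬ VibratingString.OnCurve α β ∧ ¬ VibratingString.InPositiveRegion α β) :=
  theorem3p3_general p hp.isWeight α β hα hβ
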